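/- Let $n\ge 2$, and let $\mathbb R^{\mathbb R^n}$ be the real vector space of all functions $\mathbb R^n\to\mathbb R$ with the topology $\tau_p$ of pointwise convergence. A function $f\colon\mathbb R^n\to\mathbb R$ is - a *Jones function* if its graph meets every closed set $F\subset\mathbb R^n\times\mathbb R$ whose projection on $\mathbb R^n$ is uncountable; - *almost continuous* (in the sense of Stallings) if every open subset of $\mathbb R^n\times\mathbb R$ containing the graph of $f$ contains the graph of a continuous function $\mathbb R^n\to\mathbb R$; - *Darboux* if $f[K]$ is connected for every connected $K\subset\mathbb R^n$. Let $\mathrm J(\mathbb R^n)$, $\mathrm{AC}(\mathbb R^n)$, $\mathrm D(\mathbb R^n)$ denote the respective classes. A set $M\subset\mathbb R^{\mathbb R^n}$ is *$\mu$-spaceable* if there is a $\tau_p$-closed linear subspace $V\subset M\cup\{0\}$ of (Hamel) dimension $\mu$, and $\mathcal L_p(M)$ is the least cardinal $\kappa$ such that $M\cup\{0\}$ contains no $\tau_p$-closed linear subspace of dimension $\ge\kappa$ (so $\mathcal L_p(M)=\mu^+$ if and only if $\mu$ is the maximal dimension of a $\tau_p$-closed linear subspace of $M\cup\{0\}$).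 **Theorem.** Let $n\ge2$. Then $\mathrm J(\mathbb R^n)\subset \mathrm{AC}(\mathbb R^n)\setminus \mathrm D(\mathbb R^n)$. Moreover, writing $\mathfrak c$ for the cardinality of the continuum, the class $\mathrm{AC}(\mathbb R^n)\setminus \mathrm D(\mathbb R^n)$ is $2^{\mathfrak c}$-spaceable with respect to $\tau_p$, and $\mathcal L_p(\mathrm{AC}(\mathbb R^n)\setminus \mathrm D(\mathbb R^n))=(2^{\mathfrak c})^+$. -/

import Mathlib

/-- `M ⊆ W` is `μ`-spaceable (for the topology of `W`): `M ∪ {0}` contains a closed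
linear subspace of dimension `μ`. -/
def IsSpaceable {W : Type*} [AddCommGroup W] [Module ℝ W] [TopologicalSpace W]
    (μ : Cardinal) (M : Set W) : Prop :=
  ∃ V : Submodule ℝ W, IsClosed (V : Set W) ∧ (V : Set W) ⊆ M ∪ {0} ∧ Module.rank ℝ V = μ

/-- The spaceability number of `M ⊆ W` (for the topology of `W`): the least cardinal `κ` such
that `M ∪ {0}` contains no closed linear subspace of dimension `κ` or more. It equals `μ⁺` exactly
when `μ` is the largest dimension of a closed linear subspace contained in `M ∪ {0}`. -/
noncomputable def spaceabilityNumber {W : Type*} [AddCommGroup W] [Module ℝ W]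
    [TopologicalSpace W] (M : Set W) : Cardinal :=
  sInf {κ | ¬ ∃ μ, κ ≤ μ ∧ IsSpaceable μ M}

/-- Darboux functions: images of connected sets are connected. -/
def darbouxFunctions (X : Type*) [TopologicalSpace X] : Set (X → ℝ) :=
  {f | ∀ K : Set X, IsPreconnected K → IsPreconnected (f '' K)}

/-- Almost continuous functions (in the sense of Stallings): each open subset of `X × ℝ`
containing the graph of `f` contains the graph of a continuous function. -/
def almostContinuousFunctions (X : Type*) [TopologicalSpace X] : Set (X → ℝ) :=
  {f | ∀ G : Set (X × ℝ), IsOpen G → (∀ x, (x, f x) ∈ G) →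
    ∃ g : X → ℝ, Continuous g ∧ ∀ x, (x, g x) ∈ G}

/-- Jones functions: the graph meets every closed subset of `X × ℝ` whose projection on `X` is
uncountable. -/
def jonesFunctions (X : Type*) [TopologicalSpace X] : Set (X → ℝ) :=
  {f | ∀ F : Set (X × ℝ), IsClosed F → ¬ (Prod.fst '' F).Countable → ∃ x, (x, f x) ∈ F}

/-! Let `f` be Jones and `G` open around its graph. The closed complement of `G` misses the graph,
so its projection is countable, and it contains no vertical line. Such a set can be avoided by a
continuous graph: a distance function injective on the countable projection reduces this to the
plane, where one interpolates between points off the projection. For non-Darboux, `{x | f x ≠ 0}`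
meets every uncountable closed set, hence is connected in dimension at least two, while its image
contains `1` and `-1` but not `0`. For spaceability, transfinite choice gives labels `p : X → ℝ` and
one `f` that is Jones on every fibre of `p`. The functions `(a ∘ p) * f` form a closed space
isomorphic to `ℝ → ℝ`. Its dimension `2 ^ 𝔠` is already an upper bound for that of the whole
function space. -/

open Set Filter Topology MeasureTheory

/-! ### Avoiding a closed set with countable projection: the plane -/

/-- Any two values at `a` and `b` are interpolated by a continuous function whose graph over
`[a, b]` misses `F`. -/
def Interpolable (F : Set (ℝ × ℝ)) (a b : ℝ) : Prop :=
  ∀ α β : ℝ, ∃ g : ℝ → ℝ, Continuous g ∧ g a = α ∧ g b = β ∧ ∀ x ∈ Icc a b, (x, g x) ∉ F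

theorem Interpolable.trans {F : Set (ℝ × ℝ)} {a b c : ℝ} (hab : Interpolable F a b)
    (hbc : Interpolable F b c) (h : a ≤ b) (h' : b < c) : Interpolable F a c := by
  intro α β
  obtain ⟨g, hg, hga, hgb, hgF⟩ := hab α 0
  obtain ⟨k, hk, hkb, hkc, hkF⟩ := hbc 0 β
  refine ⟨fun x => if x ≤ b then g x else k x, ?_, by simp [h, hga], by simp [h'.not_ge, hkc], ?_⟩
  · refine Continuous.if_le hg hk continuous_id continuous_const ?_
    rintro x rfl
    rw [hgb, hkb]
  · intro x hx
    by_cases hxb : x ≤ b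
    · simpa [hxb] using hgF x ⟨hx.1, hxb⟩
    · simpa [hxb] using hkF x ⟨(not_le.1 hxb).le, hx.2⟩

/-- Near a point outside the projection of a closed set, bounded values are unconstrained. -/
theorem IsClosed.exists_forall_notMem_of_notMem_fst {F : Set (ℝ × ℝ)} (hF : IsClosed F) {a : ℝ}
    (ha : a ∉ Prod.fst '' F) (M : ℝ) :
    ∃ δ > 0, ∀ x, |x - a| < δ → ∀ v, |v| ≤ M → (x, v) ∉ F := by
  obtain ⟨u, v, hu, -, hau, hv, huv⟩ := generalized_tube_lemma (isCompact_singleton (x := a))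
    (isCompact_closedBall (0 : ℝ) M) hF.isOpen_compl (by
      rintro ⟨x, y⟩ ⟨hx, -⟩ hxy
      exact ha ⟨_, hxy, hx⟩)
  obtain ⟨δ, hδ, hball⟩ := Metric.isOpen_iff.1 hu a (hau rfl)
  refine ⟨δ, hδ, fun x hx w hw => huv ⟨hball ?_, hv ?_⟩⟩
  · simpa [Real.dist_eq] using hx
  · simpa using hw

/-- The interpolant is the constant `y` plus a tent at each endpoint. Within `δ` of an endpoint any
bounded value is allowed; elsewhere the tents vanish. -/
theorem Interpolable.of_forall_notMem {F : Set (ℝ × ℝ)} (hF : IsClosed F) {a b y : ℝ} (hab : a < b)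
    (ha : a ∉ Prod.fst '' F) (hb : b ∉ Prod.fst '' F) (hy : ∀ x ∈ Icc a b, (x, y) ∉ F) :
    Interpolable F a b := by
  intro α β
  obtain ⟨δ₁, hδ₁, h₁⟩ :=
    hF.exists_forall_notMem_of_notMem_fst ha (|y| + |α - y| + |β - y|)
  obtain ⟨δ₂, hδ₂, h₂⟩ :=
    hF.exists_forall_notMem_of_notMem_fst hb (|y| + |α - y| + |β - y|)
  -- The bound `δ ≤ b - a` makes each tent vanish at the opposite endpoint.
  obtain ⟨δ, hδ, hle⟩ : ∃ δ > 0, δ ≤ δ₁ ∧ δ ≤ δ₂ ∧ δ ≤ b - a :=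
    ⟨min δ₁ (min δ₂ (b - a)), by simp [hδ₁, hδ₂, hab], by simp⟩
  obtain ⟨hle₁, hle₂, hle₃⟩ := hle
  let p : ℝ → ℝ := fun x => max 0 (1 - (x - a) / δ)
  let q : ℝ → ℝ := fun x => max 0 (1 - (b - x) / δ)
  have hbig : 1 - (b - a) / δ ≤ 0 := by
    rw [sub_nonpos, one_le_div hδ]; exact hle₃
  refine ⟨fun x => y + (α - y) * p x + (β - y) * q x, by fun_prop, ?_, ?_, ?_⟩
  · simp [p, q, hbig]
  · simp [p, q, hbig]
  · intro x hx
    have hp0 : 0 ≤ p x := le_max_left _ _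
    have hq0 : 0 ≤ q x := le_max_left _ _
    have hp1 : p x ≤ 1 :=
      max_le zero_le_one (by have := div_nonneg (sub_nonneg.2 hx.1) hδ.le; linarith)
    have hq1 : q x ≤ 1 :=
      max_le zero_le_one (by have := div_nonneg (sub_nonneg.2 hx.2) hδ.le; linarith)
    have hbound : |y + (α - y) * p x + (β - y) * q x| ≤ |y| + |α - y| + |β - y| := by
      refine (abs_add_three _ _ _).trans ?_
      rw [abs_mul, abs_mul, abs_of_nonneg hp0, abs_of_nonneg hq0]
      gcongr
      · exact mul_le_of_le_one_right (abs_nonneg _) hp1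
      · exact mul_le_of_le_one_right (abs_nonneg _) hq1
    rcases lt_or_ge (x - a) δ with h | h
    · exact h₁ x (by rw [abs_of_nonneg (sub_nonneg.2 hx.1)]; linarith) _ hbound
    rcases lt_or_ge (b - x) δ with h' | h'
    · exact h₂ x (by rw [abs_sub_comm, abs_of_nonneg (sub_nonneg.2 hx.2)]; linarith) _ hbound
    have hp : p x = 0 := max_eq_left (by rw [sub_nonpos, one_le_div hδ]; exact h)
    have hq : q x = 0 := max_eq_left (by rw [sub_nonpos, one_le_div hδ]; exact h')
    simpa [hp, hq] using hy x hx

/-- By a Lebesgue number, each short interval admits one constant height avoiding `F`; density of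
the complement of the projection supplies the cut points. -/
theorem Interpolable.of_countable {F : Set (ℝ × ℝ)} (hF : IsClosed F)
    (hC : (Prod.fst '' F).Countable) (hsec : ∀ x, ∃ y, (x, y) ∉ F) {a b : ℝ} (hab : a < b)
    (ha : a ∉ Prod.fst '' F) (hb : b ∉ Prod.fst '' F) : Interpolable F a b := by
  have hdense : Dense (Prod.fst '' F)ᶜ := hC.dense_compl ℝ
  obtain ⟨δ, hδ, hball⟩ := lebesgue_number_lemma_of_metric (isCompact_Icc (a := a) (b := b))
    (c := fun y : ℝ => {x | (x, y) ∉ F})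
    (fun y => hF.isOpen_compl.preimage (by fun_prop : Continuous fun x : ℝ => (x, y)))
    (fun x _ => mem_iUnion.2 (hsec x))
  have hstep : ∀ c d, a ≤ c → c ≤ b → c < d → d < c + δ → c ∉ Prod.fst '' F →
      d ∉ Prod.fst '' F → Interpolable F c d := by
    intro c d hac hcb hcd hdc hc hd
    obtain ⟨y, hy⟩ := hball c ⟨hac, hcb⟩
    refine .of_forall_notMem hF hcd hc hd (y := y) fun x hx => hy ?_
    rw [Metric.mem_ball, Real.dist_eq, abs_of_nonneg (sub_nonneg.2 hx.1)]
    linarith [hx.2]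
  have main : ∀ n : ℕ, ∀ c, a < c → c ≤ b → c ∉ Prod.fst '' F → c < a + n * (δ / 2) →
      Interpolable F a c := by
    intro n
    induction n with
    | zero => intro c hac _ _ h; simp at h; linarith
    | succ n ih =>
      intro c hac hcb hc h
      push_cast at h
      rcases lt_or_ge c (a + δ) with hlt | hge
      · exact hstep a c le_rfl hab.le hac hlt ha hc
      -- The gap `c - d` is below `δ`, so one step covers it, and above `δ / 2`, so the induction on
      -- `n` advances.
      · obtain ⟨d, hd, hd₁, hd₂⟩ := hdense.exists_between (show c - δ < c - δ / 2 by linarith)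
        have hda : a < d := by linarith
        exact (ih d hda (by linarith) hd (by linarith)).trans
          (hstep d c hda.le (by linarith) (by linarith) (by linarith) hd hc) hda.le (by linarith)
  obtain ⟨n, hn⟩ := exists_nat_gt ((b - a) / (δ / 2))
  rw [div_lt_iff₀ (by positivity)] at hn
  exact main n b hab le_rfl hb (by linarith)

/-- A closed subset of the plane with countable projection and no full vertical line is missed by
the graph of a continuous function. -/
theorem IsClosed.exists_continuous_forall_notMem_real {F : Set (ℝ × ℝ)} (hF : IsClosed F)
    (hC : (Prod.fst '' F).Countable) (hsec : ∀ x, ∃ y, (x, y) ∉ F) :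
    ∃ g : ℝ → ℝ, Continuous g ∧ ∀ x, (x, g x) ∉ F := by
  have hdense : Dense (Prod.fst '' F)ᶜ := hC.dense_compl ℝ
  choose d hdF hd₁ hd₂ using fun k : ℤ => hdense.exists_between (lt_add_one (k : ℝ))
  have hdd : ∀ k, d k < d (k + 1) := fun k => (hd₂ k).trans (by simpa using hd₁ (k + 1))
  choose g hg hga hgb hgF using fun k : ℤ =>
    Interpolable.of_countable hF hC hsec (hdd k) (hdF k) (hdF (k + 1)) 0 0
  -- Clamping the argument extends each piece by zero, since `g k` vanishes at both ends; the sum is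
  -- then locally finite.
  let G : ℤ → ℝ → ℝ := fun k x => g k (max (d k) (min x (d (k + 1))))
  have hGout : ∀ k x, x ∉ Ioo (d k) (d (k + 1)) → G k x = 0 := by
    intro k x hx
    rcases le_or_gt x (d k) with h | h
    · have : max (d k) (min x (d (k + 1))) = d k := max_eq_left ((min_le_left _ _).trans h)
      simp only [G, this, hga]
    · have h' : d (k + 1) ≤ x := not_lt.1 fun h' => hx ⟨h, h'⟩
      have : max (d k) (min x (d (k + 1))) = d (k + 1) := by
        rw [min_eq_right h', max_eq_right (hdd k).le]
      simp only [G, this, hgb]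
  have hGin : ∀ k x, x ∈ Icc (d k) (d (k + 1)) → G k x = g k x := by
    intro k x hx
    simp only [G, min_eq_left hx.2, max_eq_right hx.1]
  have hmono : StrictMono d := strictMono_int_of_lt_succ hdd
  refine ⟨fun x => ∑ᶠ k, G k x, continuous_finsum (fun k => by
    have := hg k
    fun_prop) ?_, ?_⟩
  · intro x
    refine ⟨Metric.ball x 1, Metric.ball_mem_nhds x one_pos,
      (finite_Icc (⌊x⌋ - 4) (⌊x⌋ + 4)).subset ?_⟩
    rintro k ⟨z, hz, hzx⟩
    have hzk : z ∈ Ioo (d k) (d (k + 1)) := by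
      by_contra h
      exact hz (hGout k z h)
    rw [Metric.mem_ball, Real.dist_eq, abs_lt] at hzx
    have h1 := hd₁ k
    have h2 := hd₂ (k + 1)
    have h3 := Int.floor_le x
    have h4 := Int.lt_floor_add_one x
    push_cast at h2
    constructor
    · have : ((⌊x⌋ - 4 : ℤ) : ℝ) ≤ k := by push_cast; linarith [hzk.1, hzk.2]
      exact_mod_cast this
    · have : (k : ℝ) ≤ ((⌊x⌋ + 4 : ℤ) : ℝ) := by push_cast; linarith [hzk.1, hzk.2]
      exact_mod_cast this
  · intro x
    obtain ⟨k, hk⟩ : ∃ k, x ∈ Ico (d k) (d (k + 1)) := by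
      have h3 := Int.floor_le x
      have h4 := Int.lt_floor_add_one x
      rcases lt_or_ge x (d ⌊x⌋) with h | h
      · refine ⟨⌊x⌋ - 1, ?_, by simpa using h⟩
        have := hd₂ (⌊x⌋ - 1)
        push_cast at this
        linarith
      · refine ⟨⌊x⌋, h, h4.trans ?_⟩
        simpa using hd₁ (⌊x⌋ + 1)
    have hsum : ∑ᶠ j, G j x = g k x := by
      rw [finsum_eq_single _ k, hGin k x (Ico_subset_Icc_self hk)]
      intro j hj
      refine hGout j x fun hxj => hj ?_
      have h1 : j < k + 1 := hmono.lt_iff_lt.1 (hxj.1.trans hk.2)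
      have h2 : k < j + 1 := hmono.lt_iff_lt.1 (hk.1.trans_lt hxj.2)
      omega
    simp only [hsum]
    exact hgF k x (Ico_subset_Icc_self hk)

/-! ### Reduction from Euclidean space to the plane; almost continuity -/

section Euclidean

variable {E : Type*} [NormedAddCommGroup E] [InnerProductSpace ℝ E] [FiniteDimensional ℝ E]

/-- Some point has pairwise different distances to the points of a given countable set. -/
theorem Set.Countable.exists_injOn_dist {C : Set E} (hC : C.Countable) :
    ∃ p : E, InjOn (fun x => dist x p) C := by
  borelize E
  -- A bad `p` lies on one of countably many perpendicular bisectors, each a null set.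
  have hnull : (Measure.addHaar : Measure E) (⋃ z ∈ (C ×ˢ C) \ diagonal E,
      (AffineSubspace.perpBisector z.1 z.2 : Set E)) = 0 := by
    rw [measure_biUnion_null_iff ((hC.prod hC).mono sdiff_subset)]
    rintro ⟨x, y⟩ ⟨-, hxy⟩
    exact Measure.addHaar_affineSubspace _ _ (by simpa using hxy)
  obtain ⟨p, hp⟩ : ∃ p, p ∉ ⋃ z ∈ (C ×ˢ C) \ diagonal E,
      (AffineSubspace.perpBisector z.1 z.2 : Set E) := by
    by_contra! h
    rw [eq_univ_of_forall h] at hnull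
    exact Measure.measure_univ_ne_zero.2 (NeZero.ne _) hnull
  refine ⟨p, fun x hx y hy hxy => by_contra fun hne => hp ?_⟩
  refine mem_biUnion (x := (x, y)) ⟨⟨hx, hy⟩, hne⟩ ?_
  simpa [AffineSubspace.mem_perpBisector_iff_dist_eq, dist_comm p] using hxy

/-- A closed subset of `E × ℝ` with countable projection and no full vertical line is missed by
the graph of a continuous function. -/
theorem IsClosed.exists_continuous_forall_notMem {F : Set (E × ℝ)} (hF : IsClosed F)
    (hC : (Prod.fst '' F).Countable) (hsec : ∀ x, ∃ y, (x, y) ∉ F) :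
    ∃ g : E → ℝ, Continuous g ∧ ∀ x, (x, g x) ∉ F := by
  obtain ⟨p, hp⟩ := hC.exists_injOn_dist
  let h : E → ℝ := fun x => dist x p
  have hproper : IsProperMap h := isProperMap_iff_tendsto_cocompact.2
    ⟨by fun_prop, (tendsto_dist_right_cocompact_atTop p).mono_right atTop_le_cocompact⟩
  have hF' : IsClosed (Prod.map h id '' F) :=
    (hproper.prodMap isProperMap_id).isClosedMap F hF
  obtain ⟨g, hg, hgF⟩ := hF'.exists_continuous_forall_notMem_real
    (by
      have : Prod.fst '' (Prod.map h id '' F) = h '' (Prod.fst '' F) := by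
        simp only [image_image, Prod.map_fst]
      rw [this]
      exact hC.image h)
    (by
      intro t
      by_cases ht : t ∈ h '' (Prod.fst '' F)
      · obtain ⟨x, hx, rfl⟩ := ht
        obtain ⟨y, hy⟩ := hsec x
        refine ⟨y, ?_⟩
        rintro ⟨⟨x', y'⟩, hz, hzy⟩
        obtain ⟨h1, rfl : y' = y⟩ := Prod.mk.inj hzy
        -- Only one point of the projection lies at distance `t`, so its free height stays free in
        -- the image.
        obtain rfl : x' = x := hp ⟨_, hz, rfl⟩ hx h1
        exact hy hz
      · refine ⟨0, ?_⟩
        rintro ⟨⟨x', y'⟩, hz, hzy⟩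
        exact ht ⟨x', ⟨_, hz, rfl⟩, (Prod.mk.inj hzy).1⟩)
  exact ⟨g ∘ h, hg.comp hproper.continuous, fun x hx => hgF (h x) ⟨_, hx, rfl⟩⟩

theorem jonesFunctions_subset_almostContinuousFunctions :
    jonesFunctions E ⊆ almostContinuousFunctions E := by
  intro f hf G hG hfG
  have hC : (Prod.fst '' Gᶜ).Countable := by
    by_contra h
    obtain ⟨x, hx⟩ := hf Gᶜ hG.isClosed_compl h
    exact hx (hfG x)
  obtain ⟨g, hg, hgG⟩ := hG.isClosed_compl.exists_continuous_forall_notMem hC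
    fun x => ⟨f x, fun h => h (hfG x)⟩
  exact ⟨g, hg, fun x => not_not.1 (hgG x)⟩

end Euclidean

/-! ### Failure of the Darboux property -/

theorem exists_mem_eq_of_mem_jonesFunctions {X : Type*} [TopologicalSpace X] {f : X → ℝ}
    (hf : f ∈ jonesFunctions X) {P : Set X} (hP : IsClosed P) (hP' : ¬ P.Countable) (y : ℝ) :
    ∃ x ∈ P, f x = y := by
  obtain ⟨x, hx, hxy⟩ := hf (P ×ˢ {y}) (hP.prod isClosed_singleton)
    (by rwa [fst_image_prod _ (singleton_nonempty y)])
  exact ⟨x, hx, hxy⟩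

/-- In dimension at least two, a set that meets every uncountable closed set is connected. -/
theorem isPreconnected_of_forall_isClosed_inter_nonempty {E : Type*} [NormedAddCommGroup E]
    [NormedSpace ℝ E] (hE : 1 < Module.rank ℝ E) {K : Set E}
    (hK : ∀ P : Set E, IsClosed P → ¬ P.Countable → (P ∩ K).Nonempty) : IsPreconnected K := by
  have : Nontrivial E := rank_pos_iff_nontrivial.1 (zero_le.trans_lt hE)
  have hdense : Dense K := by
    refine dense_iff_inter_open.2 fun U hU ⟨x, hx⟩ => ?_
    obtain ⟨ε, hε, hball⟩ := Metric.nhds_basis_closedBall.mem_iff.1 (hU.mem_nhds hx)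
    refine (hK _ Metric.isClosed_closedBall fun hc => ?_).mono (inter_subset_inter_left _ hball)
    have := hc.dense_compl ℝ
    obtain ⟨z, hz, hz'⟩ := this.inter_open_nonempty _ Metric.isOpen_ball
      ⟨x, Metric.mem_ball_self hε⟩
    exact hz' (Metric.ball_subset_closedBall hz)
  intro U V hU hV hKUV ⟨x, hxK, hxU⟩ ⟨y, hyK, hyV⟩
  have hcount : (U ∪ V)ᶜ.Countable := by
    by_contra h
    obtain ⟨z, hz, hzK⟩ := hK _ (hU.union hV).isClosed_compl h
    exact hz (hKUV hzK)
  -- `U ∪ V` is co-countable, hence connected, so `U` and `V` overlap; density of `K` puts a point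
  -- of `K` in the overlap.
  have hconn := (hcount.isConnected_compl_of_one_lt_rank hE).isPreconnected
  rw [compl_compl] at hconn
  obtain ⟨z, -, hz⟩ := hconn U V hU hV subset_rfl ⟨x, .inl hxU, hxU⟩ ⟨y, .inr hyV, hyV⟩
  obtain ⟨w, hw, hwK⟩ := hdense.inter_open_nonempty _ (hU.inter hV) ⟨z, hz⟩
  exact ⟨w, hwK, hw⟩

theorem notMem_darbouxFunctions_of_mem_jonesFunctions {E : Type*} [NormedAddCommGroup E]
    [NormedSpace ℝ E] (hE : 1 < Module.rank ℝ E) {f : E → ℝ} (hf : f ∈ jonesFunctions E) :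
    f ∉ darbouxFunctions E := by
  intro hD
  have : Nontrivial E := rank_pos_iff_nontrivial.1 (zero_le.trans_lt hE)
  have huniv : ¬ (univ : Set E).Countable := fun h => by
    simpa using (h.dense_compl ℝ).nonempty
  have hK : IsPreconnected {x | f x ≠ 0} :=
    isPreconnected_of_forall_isClosed_inter_nonempty hE fun P hP hP' => by
      obtain ⟨x, hx, hx1⟩ := exists_mem_eq_of_mem_jonesFunctions hf hP hP' 1
      exact ⟨x, hx, by simp [hx1]⟩
  obtain ⟨x, -, hx⟩ := exists_mem_eq_of_mem_jonesFunctions hf isClosed_univ huniv 1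
  obtain ⟨y, -, hy⟩ := exists_mem_eq_of_mem_jonesFunctions hf isClosed_univ huniv (-1)
  obtain ⟨z, hz, hz0⟩ := (hD _ hK).ordConnected.out ⟨y, by simp [hy], hy⟩ ⟨x, by simp [hx], hx⟩
    (show (0 : ℝ) ∈ Icc (-1) 1 by simp)
  exact hz hz0

/-! ### Transfinite construction and spaceability -/

open Cardinal

/-- At most `𝔠` sets of size at least `𝔠` have an injective choice of elements. -/
theorem exists_injective_forall_mem_of_continuum_le {T X : Type} (hT : #T ≤ 𝔠) (A : T → Set X)
    (hA : ∀ t, 𝔠 ≤ #(A t)) : ∃ x : T → X, Function.Injective x ∧ ∀ t, x t ∈ A t := by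
  -- Ordering `T` through the initial ordinal of `𝔠` leaves fewer than `𝔠` predecessors at each
  -- stage.
  obtain ⟨e⟩ : Nonempty (T ↪ (𝔠 : Cardinal.{0}).ord.ToType) := by
    rwa [← Cardinal.le_def, mk_ord_toType]
  have hwf : WellFounded fun s t => e s < e t := InvImage.wf e wellFounded_lt
  have hex : ∀ t (u : ∀ s, e s < e t → X), ∃ x ∈ A t, ∀ s hs, u s hs ≠ x := by
    intro t u
    have hlt : #(range fun s : {s // e s < e t} => u s.1 s.2) < 𝔠 := by
      refine mk_range_le.trans_lt (lt_of_le_of_lt (b := #(Iio (e t))) ?_ ?_)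
      · exact mk_le_of_injective (f := fun s : {s // e s < e t} => (⟨e s.1, s.2⟩ : Iio (e t)))
          fun a b hab => Subtype.ext (e.injective (congrArg Subtype.val hab))
      · simpa using mk_Iio_lt (e t)
    obtain ⟨x, hx, hxu⟩ := not_subset.1 fun h => (hA t).not_gt ((mk_le_mk_of_subset h).trans_lt hlt)
    exact ⟨x, hx, fun s hs h => hxu ⟨⟨s, hs⟩, h⟩⟩
  choose N hNA hN using hex
  have hfix : ∀ t, hwf.fix N t = N t fun s _ => hwf.fix N s := hwf.fix_eq N
  have hne : ∀ s t, e s < e t → hwf.fix N s ≠ hwf.fix N t := by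
    intro s t h
    rw [hfix t]
    exact hN t (fun s _ => hwf.fix N s) s h
  refine ⟨hwf.fix N, fun s t hst => ?_, fun t => hfix t ▸ hNA t _⟩
  rcases lt_trichotomy (e s) (e t) with h | h | h
  · exact absurd hst (hne s t h)
  · exact e.injective h
  · exact absurd hst.symm (hne t s h)

theorem mk_isClosed_le_continuum (X : Type*) [TopologicalSpace X] [SecondCountableTopology X] :
    #{F : Set X // IsClosed F} ≤ 𝔠 := by
  borelize X
  refine (mk_subtype_mono fun F (hF : IsClosed F) => ?_).trans
    (MeasurableSpace.cardinal_measurableSet_le_continuum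
      (s := TopologicalSpace.countableBasis X) ?_)
  · rw [← (TopologicalSpace.isBasis_countableBasis X).borel_eq_generateFrom]
    exact hF.measurableSet
  · exact (le_aleph0_iff_set_countable.2 (TopologicalSpace.countable_countableBasis X)).trans
      aleph0_le_continuum

/-- Uncountable projections of closed subsets of `X × ℝ` have size at least `𝔠`. -/
theorem IsClosed.continuum_le_mk_fst_image {X : Type} [MetricSpace X] [ProperSpace X]
    {F : Set (X × ℝ)} (hF : IsClosed F) (hF' : ¬ (Prod.fst '' F).Countable) :
    𝔠 ≤ #(Prod.fst '' F) := by
  obtain ⟨k, hk⟩ : ∃ k, ¬ (Prod.fst '' (F ∩ compactCovering (X × ℝ) k)).Countable := by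
    by_contra! h
    refine hF' ?_
    rw [← inter_univ F, ← iUnion_compactCovering, inter_iUnion, image_iUnion]
    exact countable_iUnion h
  have hcomp : IsCompact (Prod.fst '' (F ∩ compactCovering (X × ℝ) k)) :=
    ((isCompact_compactCovering _ k).inter_left hF).image continuous_fst
  -- An uncountable closed set contains a copy of the Cantor space.
  obtain ⟨φ, hφ, -, hinj⟩ := hcomp.isClosed.exists_nat_bool_injection_of_not_countable hk
  calc 𝔠 = #(ℕ → Bool) := by simp
    _ ≤ #(Prod.fst '' F) := mk_le_of_injective
      (f := fun z => ⟨φ z, image_mono inter_subset_left (hφ ⟨z, rfl⟩)⟩)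
      fun a b hab => hinj (congrArg Subtype.val hab)

/-- There is a function that is Jones on each of continuum many disjoint sets. -/
theorem exists_label_jones (X : Type) [MetricSpace X] [ProperSpace X] :
    ∃ (p : X → ℝ) (f : X → ℝ), ∀ (i : ℝ) (F : Set (X × ℝ)), IsClosed F →
      ¬ (Prod.fst '' F).Countable → ∃ x, p x = i ∧ (x, f x) ∈ F := by
  let T := ℝ × {F : Set (X × ℝ) // IsClosed F ∧ ¬ (Prod.fst '' F).Countable}
  have hT : #T ≤ 𝔠 := by
    rw [mk_prod, lift_id, lift_id, mk_real]
    exact (mul_le_mul_right ((mk_subtype_mono fun F hF => hF.1).trans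
      (mk_isClosed_le_continuum (X × ℝ))) _).trans_eq continuum_mul_self
  obtain ⟨x, hx, hxF⟩ := exists_injective_forall_mem_of_continuum_le hT
    (fun t => Prod.fst '' t.2.1) fun t => t.2.2.1.continuum_le_mk_fst_image t.2.2.2
  have hy : ∀ t, ∃ y, (x t, y) ∈ t.2.1 := fun t => by simpa using hxF t
  choose y hy using hy
  -- The default `0` off the chosen points is harmless: only existence of suitable points is
  -- required.
  refine ⟨Function.extend x (fun t => t.1) 0, Function.extend x y 0, fun i F hF hF' =>
    ⟨x (i, ⟨F, hF, hF'⟩), hx.extend_apply _ _ _, ?_⟩⟩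
  rw [hx.extend_apply]
  exact hy (i, ⟨F, hF, hF'⟩)

/-- Some closed linear subspace of dimension `2 ^ 𝔠` consists of Jones functions and zero. -/
theorem isSpaceable_jonesFunctions {X : Type} [MetricSpace X] [ProperSpace X]
    (hX : ¬ (Set.univ : Set X).Countable) : IsSpaceable (2 ^ 𝔠) (jonesFunctions X) := by
  obtain ⟨p, f, hpf⟩ := exists_label_jones X
  have hone : ∀ i, ∃ x, p x = i ∧ f x = 1 := fun i => by
    obtain ⟨x, hx, hx'⟩ := hpf i (Set.univ ×ˢ {1}) (isClosed_univ.prod isClosed_singleton)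
      (by rwa [fst_image_prod _ (singleton_nonempty _)])
    exact ⟨x, hx, hx'.2⟩
  choose s hps hfs using hone
  let L : (ℝ → ℝ) →ₗ[ℝ] (X → ℝ) :=
    { toFun := fun a x => a (p x) * f x
      map_add' := fun a b => by ext x; simp [add_mul]
      map_smul' := fun c a => by ext x; simp [mul_assoc] }
  have hL : ∀ a x, L a x = a (p x) * f x := fun _ _ => rfl
  have hinj : Function.Injective L := fun a b hab => by
    ext i
    simpa [hL, hps, hfs] using congrFun hab (s i)
  refine ⟨LinearMap.range L, ?_, ?_, ?_⟩
  -- Since `f (s i) = 1`, the coefficient `a i` is read off as `g (s i)`, so the range is cut out by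
  -- pointwise equations.
  · have hrange : (LinearMap.range L : Set (X → ℝ)) = {g | ∀ x, g x = g (s (p x)) * f x} := by
      ext g
      constructor
      · rintro ⟨a, rfl⟩ x
        simp [hL, hps, hfs]
      · intro hg
        exact ⟨fun i => g (s i), funext fun x => (hg x).symm⟩
    rw [hrange, ofPred_forall]
    exact isClosed_iInter fun x => isClosed_eq (by fun_prop) (by fun_prop)
  · rintro _ ⟨a, rfl⟩
    by_cases ha : a = 0
    · right
      simp [ha]
    left
    obtain ⟨i, hi⟩ := Function.ne_iff.1 ha
    intro F hF hF'
    -- On the fibre `p = i` the function is `a i * f`; undoing this vertical scaling keeps the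
    -- projection of `F`.
    let φ : X × ℝ ≃ₜ X × ℝ := (Homeomorph.refl X).prodCongr (Homeomorph.mulLeft₀ (a i) hi)
    obtain ⟨x, hx, hxF⟩ := hpf i (φ ⁻¹' F) (hF.preimage φ.continuous) (by
      have : Prod.fst '' (φ ⁻¹' F) = Prod.fst '' F := by
        conv_rhs => rw [← φ.image_preimage F, image_image]
        rfl
      rwa [this])
    refine ⟨x, ?_⟩
    rw [hL, hx]
    exact hxF
  · rw [← (LinearEquiv.ofInjective L hinj).rank_eq, rank_fun_infinite]
    rw [← power_def, mk_real, power_self_eq aleph0_le_continuum]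

theorem IsSpaceable.mono {W : Type*} [AddCommGroup W] [Module ℝ W] [TopologicalSpace W]
    {μ : Cardinal} {M N : Set W} (h : IsSpaceable μ M) (hMN : M ⊆ N) : IsSpaceable μ N := by
  obtain ⟨V, hV, hVM, hμ⟩ := h
  exact ⟨V, hV, hVM.trans (union_subset_union_left _ hMN), hμ⟩

theorem IsSpaceable.le_rank {W : Type*} [AddCommGroup W] [Module ℝ W] [TopologicalSpace W]
    {μ : Cardinal} {M : Set W} (h : IsSpaceable μ M) : μ ≤ Module.rank ℝ W := by
  obtain ⟨V, -, -, rfl⟩ := h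
  exact Submodule.rank_le V

theorem IsSpaceable.spaceabilityNumber_eq_succ {W : Type*} [AddCommGroup W] [Module ℝ W]
    [TopologicalSpace W] {μ : Cardinal} {M : Set W} (h : IsSpaceable μ M)
    (hμ : Module.rank ℝ W ≤ μ) : spaceabilityNumber M = Order.succ μ := by
  have hset : {κ | ¬ ∃ ν, κ ≤ ν ∧ IsSpaceable ν M} = Ici (Order.succ μ) := by
    ext κ
    rw [mem_Ici, Order.succ_le_iff]
    constructor
    · exact fun hκ => not_le.1 fun hle => hκ ⟨μ, hle, h⟩
    · rintro hκ ⟨ν, hν, hνM⟩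
      exact (hκ.trans_le hν).not_ge (hνM.le_rank.trans hμ)
  rw [spaceabilityNumber, hset, csInf_Ici]

/-- The space `EuclideanSpace ℝ (Fin n) → ℝ` of all functions carries the product topology, that
is, the topology of pointwise convergence. -/
theorem mainTheorem7 (n : ℕ) (hn : 2 ≤ n) :
    jonesFunctions (EuclideanSpace ℝ (Fin n)) ⊆
        almostContinuousFunctions (EuclideanSpace ℝ (Fin n)) \
          darbouxFunctions (EuclideanSpace ℝ (Fin n)) ∧
      IsSpaceable (2 ^ Cardinal.continuum)
        (almostContinuousFunctions (EuclideanSpace ℝ (Fin n)) \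
          darbouxFunctions (EuclideanSpace ℝ (Fin n))) ∧
      spaceabilityNumber
        (almostContinuousFunctions (EuclideanSpace ℝ (Fin n)) \
          darbouxFunctions (EuclideanSpace ℝ (Fin n))) =
        Order.succ (2 ^ Cardinal.continuum) := by
  have hrank : 1 < Module.rank ℝ (EuclideanSpace ℝ (Fin n)) := by
    rw [← Module.finrank_eq_rank, finrank_euclideanSpace_fin]
    exact_mod_cast hn
  have : Nontrivial (EuclideanSpace ℝ (Fin n)) := rank_pos_iff_nontrivial.1 (zero_le.trans_lt hrank)
  have hJ : jonesFunctions (EuclideanSpace ℝ (Fin n)) ⊆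
      almostContinuousFunctions (EuclideanSpace ℝ (Fin n)) \
        darbouxFunctions (EuclideanSpace ℝ (Fin n)) := fun f hf =>
    ⟨jonesFunctions_subset_almostContinuousFunctions hf,
      notMem_darbouxFunctions_of_mem_jonesFunctions hrank hf⟩
  have hS := (isSpaceable_jonesFunctions (X := EuclideanSpace ℝ (Fin n)) fun h => by
    simpa using (h.dense_compl ℝ).nonempty).mono hJ
  refine ⟨hJ, hS, hS.spaceabilityNumber_eq_succ ?_⟩
  have hle : #(EuclideanSpace ℝ (Fin n)) ≤ 𝔠 := by
    rw [mk_congr (WithLp.equiv 2 (Fin n → ℝ)), ← power_def, mk_real, mk_fin]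
    exact power_nat_le aleph0_le_continuum
  calc Module.rank ℝ (EuclideanSpace ℝ (Fin n) → ℝ)
      ≤ #(EuclideanSpace ℝ (Fin n) → ℝ) := rank_le_card ℝ _
    _ = 𝔠 ^ #(EuclideanSpace ℝ (Fin n)) := by rw [← power_def, mk_real]
    _ ≤ 𝔠 ^ 𝔠 := power_le_power_left continuum_ne_zero hle
    _ = 2 ^ 𝔠 := power_self_eq aleph0_le_continuum
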